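/- **Setting.** Let $(X_1,Y_1),\dots,(X_{n+m},Y_{n+m})$, $m\ge 1$, be i.i.d. random pairs with values in $\mathcal X\times\mathcal Y$; the first $n$ form the calibration sample, the last $m$ the test sample. Let $\alpha\in(0,1)$, and let $\mathcal I$ be a finite non-empty collection of measurable subsets of $\mathcal Y$ (the informative prediction sets), listed in a fixed order. Let $w(C)>0$ be the weight of $C\in\mathcal I$, and let $\hat{\mathbb P}(Y\in C\mid X=x)\in[0,1]$, $x\in\mathcal X$, $C\in\mathcal I$, be fixed estimated conditional probabilities (obtained from independent training data, conditionally on which we work), measurable in $x$; they need not be accurate. For $\mu\ge 0$ put $$\hat\ell_{x,C}(\mu)=w(C)\,\hat{\mathbb P}(Y\in C\mid X=x)+\mu\left(\hat{\mathbb P}(Y\in C\mid X=x)-(1-\alpha)\right).$$ Let $C^\mu(x)\in\arg\max_{C\in\mathcal I}\hat\ell_{x,C}(\mu)$, with ties broken in favor of the smallest weight and remaining ties in favor of the smallest index in the list, and let $D^\mu(x)=\mathbb I\{\max_{C\in\mathcal I}\hat\ell_{x,C}(\mu)>0\}$. The data-driven procedure OGInfoSP uses $$\mu_\alpha=\min\left\{\mu\ge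 0:\ \frac{\frac1{n+1}\left(1+\sum_{i=1}^n\mathbb I\{Y_i\notin C^\mu(X_i)\}D^\mu(X_i)\right)}{\frac1m\left(1\vee\sum_{i=1}^m D^\mu(X_{n+i})\right)}\le\alpha\right\},$$ with $\mu_\alpha=\infty$ and $D^\infty\equiv 0$ if no such $\mu$ exists, and reports the prediction set $C^{\mu_\alpha}(X_{n+i})$ for each $i\in\{1,\dots,m\}$ with $D^{\mu_\alpha}(X_{n+i})=1$. **Theorem.** Assume nestedness: $C^{\mu_1}(x)\subseteq C^{\mu_2}(x)$ for all $x\in\mathcal X$ and all $0\le\mu_1<\mu_2$. Then the minimum defining $\mu_\alpha$ is attained whenever the set is non-empty, the false coverage proportion below is an integrable random variable, and OGInfoSP controls the false coverage rate at level $\alpha$ in finite samples: $$\mathrm{FCR}=\mathbb E\left[\frac{\sum_{i=1}^m\mathbb I\{Y_{n+i}\notin C^{\mu_\alpha}(X_{n+i})\}\,D^{\mu_\alpha}(X_{n+i})}{1\vee\sum_{i=1}^m D^{\mu_\alpha}(X_{n+i})}\right]\le\alpha.$$ -/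

import Mathlib

open MeasureTheory ProbabilityTheory
open scoped NNReal ENNReal

noncomputable section

namespace OGInfoSP

/-! In all definitions below, the finite collection of informative prediction sets is listed in a
fixed order as `I 0, …, I (N - 1)`; `w C` is the weight of the set `C`, and `phat x C` is the
estimated conditional probability that the outcome lies in `C` given that the covariate is `x`. -/

variable {𝒳 𝒴 : Type*} {N : ℕ}

/-- The line `μ ↦ w(C) P̂(Y ∈ C | X = x) + μ (P̂(Y ∈ C | X = x) - (1 - α))`. -/
def line (α : ℝ) (w : Set 𝒴 → ℝ) (phat : 𝒳 → Set 𝒴 → ℝ) (x : 𝒳) (C : Set 𝒴) (μ : ℝ≥0) : ℝ :=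
  w C * phat x C + (μ : ℝ) * (phat x C - (1 - α))

/-- The upper envelope `max_C line_{x,C}(μ)` over the informative prediction sets. -/
def envelope [NeZero N] (α : ℝ) (I : Fin N → Set 𝒴) (w : Set 𝒴 → ℝ) (phat : 𝒳 → Set 𝒴 → ℝ)
    (μ : ℝ≥0) (x : 𝒳) : ℝ :=
  Finset.univ.sup' Finset.univ_nonempty fun k : Fin N => line α w phat x (I k) μ

open scoped Classical in
/-- Indices of the sets whose line attains the upper envelope at `μ`. -/
def maximizers (α : ℝ) (I : Fin N → Set 𝒴) (w : Set 𝒴 → ℝ) (phat : 𝒳 → Set 𝒴 → ℝ)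
    (μ : ℝ≥0) (x : 𝒳) : Finset (Fin N) :=
  {k | ∀ j, line α w phat x (I j) μ ≤ line α w phat x (I k) μ}

open scoped Classical in
/-- Indices of the maximizers of smallest weight. -/
def lightMaximizers (α : ℝ) (I : Fin N → Set 𝒴) (w : Set 𝒴 → ℝ) (phat : 𝒳 → Set 𝒴 → ℝ)
    (μ : ℝ≥0) (x : 𝒳) : Finset (Fin N) :=
  {k ∈ maximizers α I w phat μ x | ∀ j ∈ maximizers α I w phat μ x, w (I k) ≤ w (I j)}

theorem lightMaximizers_nonempty [NeZero N] (α : ℝ) (I : Fin N → Set 𝒴) (w : Set 𝒴 → ℝ)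
    (phat : 𝒳 → Set 𝒴 → ℝ) (μ : ℝ≥0) (x : 𝒳) : (lightMaximizers α I w phat μ x).Nonempty := by
  have h1 : (maximizers α I w phat μ x).Nonempty := by
    obtain ⟨k, -, hk⟩ := Finset.exists_max_image (Finset.univ : Finset (Fin N))
      (fun k => line α w phat x (I k) μ) Finset.univ_nonempty
    exact ⟨k, by simpa [maximizers] using hk⟩
  obtain ⟨k, hk, hmin⟩ := Finset.exists_min_image _ (fun k => w (I k)) h1
  exact ⟨k, by simpa [lightMaximizers] using ⟨hk, hmin⟩⟩

/-- The candidate set `C^μ(x)`: it attains the upper envelope at `μ`; ties are broken in favor of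
the smallest weight, and remaining ties in favor of the smallest index in the list. -/
def predSet [NeZero N] (α : ℝ) (I : Fin N → Set 𝒴) (w : Set 𝒴 → ℝ) (phat : 𝒳 → Set 𝒴 → ℝ)
    (μ : ℝ≥0) (x : 𝒳) : Set 𝒴 :=
  I ((lightMaximizers α I w phat μ x).min' (lightMaximizers_nonempty α I w phat μ x))

open scoped Classical in
/-- The decision indicator `D^μ(x)`: one if the upper envelope is positive, zero otherwise. -/
def decision [NeZero N] (α : ℝ) (I : Fin N → Set 𝒴) (w : Set 𝒴 → ℝ) (phat : 𝒳 → Set 𝒴 → ℝ)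
    (μ : ℝ≥0) (x : 𝒳) : ℝ :=
  if 0 < envelope α I w phat μ x then 1 else 0

/-- Nestedness: `C^μ(x)` grows with `μ`, for every `x`. -/
def Nested [NeZero N] (α : ℝ) (I : Fin N → Set 𝒴) (w : Set 𝒴 → ℝ)
    (phat : 𝒳 → Set 𝒴 → ℝ) : Prop :=
  ∀ (x : 𝒳) (μ₁ μ₂ : ℝ≥0), μ₁ < μ₂ → predSet α I w phat μ₁ x ⊆ predSet α I w phat μ₂ x

open scoped Classical in
/-- The indicator that `y` is not in `C`. -/
def miss (C : Set 𝒴) (y : 𝒴) : ℝ := if y ∉ C then 1 else 0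

/-- The estimated false coverage proportion at `μ`. The first `n` entries of `z` are the calibration
sample, the last `m` entries the test sample, of which only the covariates are used. -/
def fcpHat [NeZero N] {n m : ℕ} (α : ℝ) (I : Fin N → Set 𝒴) (w : Set 𝒴 → ℝ)
    (phat : 𝒳 → Set 𝒴 → ℝ) (z : Fin (n + m) → 𝒳 × 𝒴) (μ : ℝ≥0) : ℝ :=
  (1 / ((n : ℝ) + 1) *
      (1 + ∑ i : Fin n, miss (predSet α I w phat μ (z (Fin.castAdd m i)).1) (z (Fin.castAdd m i)).2 *
        decision α I w phat μ (z (Fin.castAdd m i)).1)) /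
    (1 / (m : ℝ) * max 1 (∑ i : Fin m, decision α I w phat μ (z (Fin.natAdd n i)).1))

/-- The values `μ ≥ 0` at which the estimated false coverage proportion is at most `α`. -/
def feasible [NeZero N] {n m : ℕ} (α : ℝ) (I : Fin N → Set 𝒴) (w : Set 𝒴 → ℝ)
    (phat : 𝒳 → Set 𝒴 → ℝ) (z : Fin (n + m) → 𝒳 × 𝒴) : Set ℝ≥0 :=
  {μ | fcpHat α I w phat z μ ≤ α}

/-- The data-driven multiplier `μ_α`: the smallest feasible `μ`, and `∞` if there is none. -/
def muAlpha [NeZero N] {n m : ℕ} (α : ℝ) (I : Fin N → Set 𝒴) (w : Set 𝒴 → ℝ)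
    (phat : 𝒳 → Set 𝒴 → ℝ) (z : Fin (n + m) → 𝒳 × 𝒴) : ℝ≥0∞ :=
  sInf ((fun μ : ℝ≥0 => (μ : ℝ≥0∞)) '' feasible α I w phat z)

/-- `D^μ(x)` for `μ ∈ [0, ∞]`, with `D^∞ = 0`. -/
def decisionTop [NeZero N] (α : ℝ) (I : Fin N → Set 𝒴) (w : Set 𝒴 → ℝ)
    (phat : 𝒳 → Set 𝒴 → ℝ) (μ : ℝ≥0∞) (x : 𝒳) : ℝ :=
  if μ = ∞ then 0 else decision α I w phat μ.toNNReal x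

/-- `C^μ(x)` for `μ ∈ [0, ∞]`; the value at `∞` plays no role, as nothing is selected there. -/
def predSetTop [NeZero N] (α : ℝ) (I : Fin N → Set 𝒴) (w : Set 𝒴 → ℝ)
    (phat : 𝒳 → Set 𝒴 → ℝ) (μ : ℝ≥0∞) (x : 𝒳) : Set 𝒴 :=
  if μ = ∞ then ∅ else predSet α I w phat μ.toNNReal x

/-- The false coverage proportion of the procedure on the test sample: the fraction of the reported
prediction sets that miss their outcome. -/
def fcp [NeZero N] {n m : ℕ} (α : ℝ) (I : Fin N → Set 𝒴) (w : Set 𝒴 → ℝ)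
    (phat : 𝒳 → Set 𝒴 → ℝ) (z : Fin (n + m) → 𝒳 × 𝒴) : ℝ :=
  (∑ i : Fin m,
      miss (predSetTop α I w phat (muAlpha α I w phat z) (z (Fin.natAdd n i)).1)
          (z (Fin.natAdd n i)).2 *
        decisionTop α I w phat (muAlpha α I w phat z) (z (Fin.natAdd n i)).1) /
    max 1 (∑ i : Fin m, decisionTop α I w phat (muAlpha α I w phat z) (z (Fin.natAdd n i)).1)

end OGInfoSP

end

/-! The proof is a leave-one-out exchangeability argument. For the `j`-th test point, replace the `1
+` in the numerator of the estimate by the error of that point, and count it as selected in the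
denominator. The resulting `symmEstimate`, hence its first level at most `α`, is symmetric in the
calibration points and point `j`. If point `j` is an error at `μ_α`, it is an error at all smaller
levels, because errors decrease in `μ` (nestedness and antitone decisions). Both estimates then
agree on `[0, μ_α]`, so both stop at `μ_α` (`firstBelow_symmEstimate`). Feasibility at `μ_α` bounds
the false coverage proportion by `α (n + 1) / m` times the sum over `j` of the share of point `j` in
the errors among the `n + 1` symmetric points (`proportion_le_sum_errorShare`). These shares sum to
at most one and have equal means, so each has mean at most `1 / (n + 1)`; summing over `j` gives
`α`. Attainment and measurability of `μ_α` rest on local constancy to the right (`decision_right`,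
`predIndex_right`), for which the tie-breaking by weight is essential. -/

open Filter Topology

namespace OGInfoSP

/-! ### First passage levels of right-locally constant functions. -/

section FirstBelow

/-- The infimum in `[0, ∞]` of the sublevel set `{μ | F μ ≤ c}`. -/
noncomputable def firstBelow (F : ℝ≥0 → ℝ) (c : ℝ) : ℝ≥0∞ :=
  sInf ((fun μ : ℝ≥0 => (μ : ℝ≥0∞)) '' {μ | F μ ≤ c})

theorem firstBelow_eq_coe {F : ℝ≥0 → ℝ} {c : ℝ} {μ : ℝ≥0} (h : IsLeast {μ | F μ ≤ c} μ) :
    firstBelow F c = μ := by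
  apply IsLeast.csInf_eq
  refine ⟨⟨μ, h.1, rfl⟩, ?_⟩
  rintro _ ⟨ν, hν, rfl⟩
  exact ENNReal.coe_le_coe.2 (h.2 hν)

theorem exists_isLeast_of_eventually_eq {F : ℝ≥0 → ℝ} {c : ℝ}
    (hF : ∀ μ, ∀ᶠ ν in 𝓝[≥] μ, F ν = F μ) (hne : {μ | F μ ≤ c}.Nonempty) :
    ∃ μ, IsLeast {μ | F μ ≤ c} μ := by
  set S := {μ | F μ ≤ c} with hS
  have hglb : IsGLB S (sInf S) := isGLB_csInf hne (OrderBot.bddBelow S)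
  refine ⟨sInf S, ?_, hglb.1⟩
  obtain ⟨ν, hν, hνS⟩ := ((hglb.frequently_mem hne).and_eventually
    ((hF (sInf S)))).exists
  · rw [hS, Set.mem_ofPred_eq] at hν ⊢
    rwa [← hνS]

/-- Right constancy extends one witness to an interval of witnesses, which meets the dense set. With
a countable `s` this makes the first level measurable. -/
theorem firstBelow_lt_iff {F : ℝ≥0 → ℝ} {c : ℝ} (hF : ∀ μ, ∀ᶠ ν in 𝓝[≥] μ, F ν = F μ)
    {s : Set ℝ≥0} (hs : Dense s) (a : ℝ≥0∞) :
    firstBelow F c < a ↔ ∃ q ∈ s, (q : ℝ≥0∞) < a ∧ F q ≤ c := by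
  rw [firstBelow, sInf_lt_iff]
  constructor
  · rintro ⟨_, ⟨μ, hμ, rfl⟩, hlt⟩
    have h1 : ∀ᶠ ν : ℝ≥0 in 𝓝[>] μ, F ν = F μ ∧ (ν : ℝ≥0∞) < a :=
      ((hF μ).filter_mono (nhdsWithin_mono _ Set.Ioi_subset_Ici_self)).and
        (nhdsWithin_le_nhds ((ENNReal.continuous_coe.tendsto μ).eventually_lt_const hlt))
    obtain ⟨u, hu, hsub⟩ := (mem_nhdsGT_iff_exists_Ioo_subset).1 h1
    obtain ⟨q, hq, hqs⟩ := hs.exists_between hu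
    exact ⟨q, hq, (hsub hqs).2, (hsub hqs).1.trans_le hμ⟩
  · rintro ⟨q, -, hq, hFq⟩
    exact ⟨q, ⟨q, hFq, rfl⟩, hq⟩

theorem measurable_firstBelow {E : Type*} [MeasurableSpace E] {F : E → ℝ≥0 → ℝ} {c : ℝ}
    (hF : ∀ z μ, ∀ᶠ ν in 𝓝[≥] μ, F z ν = F z μ) (hmeas : ∀ μ, Measurable fun z => F z μ) :
    Measurable fun z => firstBelow (F z) c := by
  obtain ⟨s, hsc, hsd⟩ := TopologicalSpace.exists_countable_dense ℝ≥0
  refine measurable_of_Iio fun a => ?_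
  have : (fun z => firstBelow (F z) c) ⁻¹' Set.Iio a =
      ⋃ q ∈ s, {z | (q : ℝ≥0∞) < a ∧ F z q ≤ c} := by
    ext z
    simp [firstBelow_lt_iff (hF z) hsd a, and_left_comm]
  rw [this]
  exact MeasurableSet.biUnion hsc fun q _ =>
    (MeasurableSet.const _).inter (measurableSet_le (hmeas q) measurable_const)

end FirstBelow

/-! ### Control of the false selection proportion for abstract selections. -/

section Selection

variable {E : Type*}

/-- A family of selection indicators `D μ` and of error indicators `M μ ≤ D μ`, both locally
constant on the right in `μ`, the errors being antitone in `μ`. -/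
structure IsSelection [MeasurableSpace E] (M D : ℝ≥0 → E → ℝ) : Prop where
  err_zero_or_one : ∀ μ e, M μ e = 0 ∨ M μ e = 1
  sel_zero_or_one : ∀ μ e, D μ e = 0 ∨ D μ e = 1
  err_le_sel : ∀ μ e, M μ e ≤ D μ e
  err_antitone : ∀ e, Antitone fun μ => M μ e
  err_right : ∀ e μ, ∀ᶠ ν in 𝓝[≥] μ, M ν e = M μ e
  sel_right : ∀ e μ, ∀ᶠ ν in 𝓝[≥] μ, D ν e = D μ e
  measurable_err : Measurable fun p : ℝ≥0 × E => M p.1 p.2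
  measurable_sel : Measurable fun p : ℝ≥0 × E => D p.1 p.2

/-- The extension of a family indexed by `[0, ∞)` by zero at `∞`. -/
noncomputable def extendTop (M : ℝ≥0 → E → ℝ) (μ : ℝ≥0∞) (e : E) : ℝ :=
  if μ = ∞ then 0 else M μ.toNNReal e

@[simp] theorem extendTop_top (M : ℝ≥0 → E → ℝ) (e : E) : extendTop M ∞ e = 0 := if_pos rfl

@[simp] theorem extendTop_coe (M : ℝ≥0 → E → ℝ) (μ : ℝ≥0) (e : E) :
    extendTop M μ e = M μ e := by simp [extendTop]

variable [MeasurableSpace E]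

theorem measurable_extendTop {M : ℝ≥0 → E → ℝ}
    (hM : Measurable fun p : ℝ≥0 × E => M p.1 p.2) :
    Measurable fun p : ℝ≥0∞ × E => extendTop M p.1 p.2 := by
  unfold extendTop
  refine Measurable.ite (measurable_fst (measurableSet_singleton _)) measurable_const ?_
  exact hM.comp ((ENNReal.measurable_toNNReal.comp measurable_fst).prodMk measurable_snd)

variable {M D : ℝ≥0 → E → ℝ} {n m : ℕ}

namespace IsSelection

theorem err_nonneg (h : IsSelection M D) (μ : ℝ≥0) (e : E) : 0 ≤ M μ e := by
  rcases h.err_zero_or_one μ e with h | h <;> simp [h]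

theorem sel_eq_one (h : IsSelection M D) {μ : ℝ≥0} {e : E} (he : M μ e = 1) : D μ e = 1 := by
  have := h.err_le_sel μ e
  rcases h.sel_zero_or_one μ e with h | h <;> linarith

theorem err_eq_one_of_le (h : IsSelection M D) {μ ν : ℝ≥0} {e : E} (hνμ : ν ≤ μ)
    (he : M μ e = 1) : M ν e = 1 := by
  have : M μ e ≤ M ν e := h.err_antitone e hνμ
  rcases h.err_zero_or_one ν e with h | h <;> linarith

theorem extendTop_err_nonneg (h : IsSelection M D) (μ : ℝ≥0∞) (e : E) :
    0 ≤ extendTop M μ e := by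
  induction μ with
  | top => simp
  | coe μ => simpa using h.err_nonneg μ e

theorem extendTop_err_le_sel (h : IsSelection M D) (μ : ℝ≥0∞) (e : E) :
    extendTop M μ e ≤ extendTop D μ e := by
  induction μ with
  | top => simp
  | coe μ => simpa using h.err_le_sel μ e

end IsSelection

/-- The estimated false selection proportion, which uses the errors on the first `n` points and the
selections on the last `m` points. -/
noncomputable def estimate (M D : ℝ≥0 → E → ℝ) (z : Fin (n + m) → E) (μ : ℝ≥0) : ℝ :=
  (1 / ((n : ℝ) + 1) * (1 + ∑ i : Fin n, M μ (z (Fin.castAdd m i)))) /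
    (1 / (m : ℝ) * max 1 (∑ i : Fin m, D μ (z (Fin.natAdd n i))))

/-- The indices of the first `n` points together with the `j`-th of the last `m` points. -/
def calibrationWith (n : ℕ) {m : ℕ} (j : Fin m) : Finset (Fin (n + m)) :=
  insert (Fin.natAdd n j) (Finset.univ.map (Fin.castAddEmb m))

/-- The variant of `estimate` in which the `j`-th test point is counted as an error. It is symmetric
in the points of `calibrationWith n j`. -/
noncomputable def symmEstimate (M D : ℝ≥0 → E → ℝ) (j : Fin m) (z : Fin (n + m) → E)
    (μ : ℝ≥0) : ℝ :=
  (1 / ((n : ℝ) + 1) * ∑ i ∈ calibrationWith n j, M μ (z i)) /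
    (1 / (m : ℝ) * (1 + ∑ i ∈ Finset.univ.erase j, D μ (z (Fin.natAdd n i))))

/-- The share of the `i`-th point in the errors made on `calibrationWith n j` at the first level
where `symmEstimate` is at most `c`. -/
noncomputable def errorShare (M D : ℝ≥0 → E → ℝ) (c : ℝ) (j : Fin m) (i : Fin (n + m))
    (z : Fin (n + m) → E) : ℝ :=
  extendTop M (firstBelow (symmEstimate M D j z) c) (z i) /
    ∑ k ∈ calibrationWith n j, extendTop M (firstBelow (symmEstimate M D j z) c) (z k)

/-- The false selection proportion on the last `m` points at the first level where `estimate` is at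
most `c`. -/
noncomputable def proportion (M D : ℝ≥0 → E → ℝ) (c : ℝ) (z : Fin (n + m) → E) : ℝ :=
  (∑ i : Fin m, extendTop M (firstBelow (estimate M D z) c) (z (Fin.natAdd n i))) /
    max 1 (∑ i : Fin m, extendTop D (firstBelow (estimate M D z) c) (z (Fin.natAdd n i)))

theorem natAdd_notMem_map_castAdd (j : Fin m) :
    Fin.natAdd n j ∉ Finset.univ.map (Fin.castAddEmb (n := n) m) := by
  simp only [Finset.mem_map, Finset.mem_univ, true_and, not_exists]
  intro i hi
  have h1 := congrArg Fin.val hi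
  have h2 := i.isLt
  simp at h1
  omega

theorem sum_calibrationWith (j : Fin m) (f : Fin (n + m) → ℝ) :
    ∑ i ∈ calibrationWith n j, f i = f (Fin.natAdd n j) + ∑ i : Fin n, f (Fin.castAdd m i) := by
  rw [calibrationWith, Finset.sum_insert (natAdd_notMem_map_castAdd j), Finset.sum_map]
  rfl

theorem card_calibrationWith (n : ℕ) (j : Fin m) : (calibrationWith n j).card = n + 1 := by
  rw [calibrationWith, Finset.card_insert_of_notMem (natAdd_notMem_map_castAdd j)]
  simp

theorem natAdd_mem_calibrationWith (n : ℕ) (j : Fin m) :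
    Fin.natAdd n j ∈ calibrationWith n j := Finset.mem_insert_self _ _

theorem natAdd_notMem_calibrationWith {j k : Fin m} (h : k ≠ j) :
    Fin.natAdd n k ∉ calibrationWith n j := by
  rw [calibrationWith, Finset.mem_insert, not_or]
  exact ⟨fun h' => h (Fin.natAdd_injective _ _ h'), natAdd_notMem_map_castAdd k⟩

section Symmetry

variable {j : Fin m} {a b : Fin (n + m)}

theorem sum_calibrationWith_swap (ha : a ∈ calibrationWith n j) (hb : b ∈ calibrationWith n j)
    (f : Fin (n + m) → ℝ) :
    ∑ i ∈ calibrationWith n j, f (Equiv.swap a b i) = ∑ i ∈ calibrationWith n j, f i := by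
  refine Finset.sum_equiv (Equiv.swap a b) (fun i => ?_) fun _ _ => rfl
  by_cases hia : i = a
  · subst hia; simp [ha, hb]
  by_cases hib : i = b
  · subst hib; simp [ha, hb]
  rw [Equiv.swap_apply_of_ne_of_ne hia hib]

-- The numerator is a sum over `calibrationWith n j`, merely reindexed by the swap; the denominator
-- sees only the other test points, which the swap fixes.
omit [MeasurableSpace E] in
theorem symmEstimate_swap (ha : a ∈ calibrationWith n j) (hb : b ∈ calibrationWith n j)
    (z : Fin (n + m) → E) :
    symmEstimate M D j (z ∘ Equiv.swap a b) = symmEstimate M D j z := by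
  funext μ
  unfold symmEstimate
  have h1 := sum_calibrationWith_swap ha hb fun i => M μ (z i)
  have h2 : ∑ i ∈ Finset.univ.erase j, D μ ((z ∘ Equiv.swap a b) (Fin.natAdd n i)) =
      ∑ i ∈ Finset.univ.erase j, D μ (z (Fin.natAdd n i)) := by
    refine Finset.sum_congr rfl fun i hi => ?_
    have hi' := natAdd_notMem_calibrationWith (n := n) (Finset.ne_of_mem_erase hi)
    rw [Function.comp_apply, Equiv.swap_apply_of_ne_of_ne]
    · exact fun h => hi' (h ▸ ha)
    · exact fun h => hi' (h ▸ hb)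
  rw [h2]
  simp only [Function.comp_apply, h1]

omit [MeasurableSpace E] in
theorem errorShare_swap (c : ℝ) (ha : a ∈ calibrationWith n j) (hb : b ∈ calibrationWith n j)
    (z : Fin (n + m) → E) :
    errorShare M D c j a (z ∘ Equiv.swap a b) = errorShare M D c j b z := by
  unfold errorShare
  rw [symmEstimate_swap ha hb]
  have h1 := sum_calibrationWith_swap ha hb fun i =>
    extendTop M (firstBelow (symmEstimate M D j z) c) (z i)
  simp only [Function.comp_apply, h1, Equiv.swap_apply_left]

end Symmetry

/-! ### Measurability and pointwise bounds. -/

namespace IsSelection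

variable (h : IsSelection M D)
include h

theorem estimate_right (z : Fin (n + m) → E) (μ : ℝ≥0) :
    ∀ᶠ ν in 𝓝[≥] μ, estimate M D z ν = estimate M D z μ := by
  filter_upwards [eventually_all.2 fun i : Fin (n + m) => h.err_right (z i) μ,
    eventually_all.2 fun i : Fin (n + m) => h.sel_right (z i) μ] with ν h1 h2
  simp only [estimate, h1, h2]

theorem symmEstimate_right (j : Fin m) (z : Fin (n + m) → E) (μ : ℝ≥0) :
    ∀ᶠ ν in 𝓝[≥] μ, symmEstimate M D j z ν = symmEstimate M D j z μ := by
  filter_upwards [eventually_all.2 fun i : Fin (n + m) => h.err_right (z i) μ,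
    eventually_all.2 fun i : Fin (n + m) => h.sel_right (z i) μ] with ν h1 h2
  simp only [symmEstimate, h1, h2]

theorem measurable_estimate (μ : ℝ≥0) :
    Measurable fun z : Fin (n + m) → E => estimate M D z μ := by
  have hM : Measurable (M μ) := h.measurable_err.comp measurable_prodMk_left
  have hD : Measurable (D μ) := h.measurable_sel.comp measurable_prodMk_left
  unfold estimate
  fun_prop

theorem measurable_symmEstimate (j : Fin m) (μ : ℝ≥0) :
    Measurable fun z : Fin (n + m) → E => symmEstimate M D j z μ := by
  have hM : Measurable (M μ) := h.measurable_err.comp measurable_prodMk_left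
  have hD : Measurable (D μ) := h.measurable_sel.comp measurable_prodMk_left
  unfold symmEstimate
  fun_prop

theorem measurable_proportion (c : ℝ) :
    Measurable fun z : Fin (n + m) → E => proportion M D c z := by
  have hμ : Measurable fun z : Fin (n + m) → E => firstBelow (estimate M D z) c :=
    measurable_firstBelow h.estimate_right h.measurable_estimate
  have hM (i : Fin (n + m)) : Measurable fun z : Fin (n + m) → E =>
      extendTop M (firstBelow (estimate M D z) c) (z i) :=
    (measurable_extendTop h.measurable_err).comp (hμ.prodMk (measurable_pi_apply i))
  have hD (i : Fin (n + m)) : Measurable fun z : Fin (n + m) → E =>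
      extendTop D (firstBelow (estimate M D z) c) (z i) :=
    (measurable_extendTop h.measurable_sel).comp (hμ.prodMk (measurable_pi_apply i))
  unfold proportion
  fun_prop

theorem measurable_errorShare (c : ℝ) (j : Fin m) (i : Fin (n + m)) :
    Measurable fun z : Fin (n + m) → E => errorShare M D c j i z := by
  have hμ : Measurable fun z : Fin (n + m) → E => firstBelow (symmEstimate M D j z) c :=
    measurable_firstBelow (h.symmEstimate_right j) (h.measurable_symmEstimate j)
  have hM (i : Fin (n + m)) : Measurable fun z : Fin (n + m) → E =>
      extendTop M (firstBelow (symmEstimate M D j z) c) (z i) :=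
    (measurable_extendTop h.measurable_err).comp (hμ.prodMk (measurable_pi_apply i))
  unfold errorShare
  fun_prop

theorem errorShare_nonneg (c : ℝ) (j : Fin m) (i : Fin (n + m)) (z : Fin (n + m) → E) :
    0 ≤ errorShare M D c j i z :=
  div_nonneg (h.extendTop_err_nonneg _ _) (Finset.sum_nonneg fun _ _ => h.extendTop_err_nonneg _ _)

omit [MeasurableSpace E] h in
theorem sum_errorShare_le_one (c : ℝ) (j : Fin m) (z : Fin (n + m) → E) :
    ∑ i ∈ calibrationWith n j, errorShare M D c j i z ≤ 1 := by
  unfold errorShare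
  rw [← Finset.sum_div]
  -- Only an inequality: with no errors the quotient is `0 / 0 = 0`.
  exact div_self_le_one _

theorem errorShare_le_one (c : ℝ) (j : Fin m) {i : Fin (n + m)} (hi : i ∈ calibrationWith n j)
    (z : Fin (n + m) → E) : errorShare M D c j i z ≤ 1 :=
  (Finset.single_le_sum (f := fun i => errorShare M D c j i z)
    (fun k _ => h.errorShare_nonneg c j k z) hi).trans (sum_errorShare_le_one c j z)

theorem proportion_nonneg (c : ℝ) (z : Fin (n + m) → E) : 0 ≤ proportion M D c z :=
  div_nonneg (Finset.sum_nonneg fun _ _ => h.extendTop_err_nonneg _ _)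
    (zero_le_one.trans (le_max_left _ _))

theorem proportion_le_one (c : ℝ) (z : Fin (n + m) → E) : proportion M D c z ≤ 1 :=
  div_le_one_of_le₀ ((Finset.sum_le_sum fun _ _ => h.extendTop_err_le_sel _ _).trans
    (le_max_right _ _)) (zero_le_one.trans (le_max_left _ _))

/-- An error at point `j` supplies the `1` in the numerator. It also forces selection of `j`, so the
maximum with `1` is inactive. -/
theorem symmEstimate_eq_estimate {j : Fin m} {z : Fin (n + m) → E} {μ : ℝ≥0}
    (hj : M μ (z (Fin.natAdd n j)) = 1) : symmEstimate M D j z μ = estimate M D z μ := by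
  unfold symmEstimate estimate
  have h1 : ∑ i : Fin m, D μ (z (Fin.natAdd n i)) =
      1 + ∑ i ∈ Finset.univ.erase j, D μ (z (Fin.natAdd n i)) := by
    rw [← Finset.add_sum_erase _ _ (Finset.mem_univ j), h.sel_eq_one hj]
  have h2 : 0 ≤ ∑ i ∈ Finset.univ.erase j, D μ (z (Fin.natAdd n i)) :=
    Finset.sum_nonneg fun i _ => (h.err_nonneg _ _).trans (h.err_le_sel _ _)
  rw [sum_calibrationWith, hj, h1, max_eq_right (by linarith)]

/-- Antitone errors keep `j` an error below `μ`, so the two estimates coincide on `[0, μ]`. -/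
theorem firstBelow_symmEstimate {c : ℝ} {j : Fin m} {z : Fin (n + m) → E} {μ : ℝ≥0}
    (hμ : IsLeast {μ | estimate M D z μ ≤ c} μ) (hj : M μ (z (Fin.natAdd n j)) = 1) :
    firstBelow (symmEstimate M D j z) c = μ := by
  refine firstBelow_eq_coe ⟨?_, fun ν hν => ?_⟩
  · rw [Set.mem_ofPred_eq, h.symmEstimate_eq_estimate hj]
    exact hμ.1
  · by_contra! hlt
    rw [Set.mem_ofPred_eq, h.symmEstimate_eq_estimate (h.err_eq_one_of_le hlt.le hj)] at hν
    exact hlt.not_ge (hμ.2 hν)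

theorem proportion_le_sum_errorShare (hm : 0 < m) {c : ℝ} (hc : 0 ≤ c) (z : Fin (n + m) → E) :
    proportion M D c z ≤
      c * ((n : ℝ) + 1) / m * ∑ j : Fin m, errorShare M D c j (Fin.natAdd n j) z := by
  have hrhs : 0 ≤ c * ((n : ℝ) + 1) / m *
      ∑ j : Fin m, errorShare M D c j (Fin.natAdd n j) z :=
    mul_nonneg (by positivity) (Finset.sum_nonneg fun j _ => h.errorShare_nonneg _ _ _ _)
  rcases Set.eq_empty_or_nonempty {μ | estimate M D z μ ≤ c} with hempty | hne
  · have : firstBelow (estimate M D z) c = ∞ := by simp [firstBelow, hempty]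
    simpa [proportion, this] using hrhs
  obtain ⟨μ, hμ⟩ := exists_isLeast_of_eventually_eq (h.estimate_right z) hne
  rw [proportion, firstBelow_eq_coe hμ, Finset.sum_div, Finset.mul_sum]
  simp only [extendTop_coe]
  refine Finset.sum_le_sum fun j _ => ?_
  -- The two first levels may differ when `j` is not an error, but then its term on the left
  -- vanishes.
  rcases h.err_zero_or_one μ (z (Fin.natAdd n j)) with h0 | h1
  · rw [h0, zero_div]
    exact mul_nonneg (by positivity) (h.errorShare_nonneg _ _ _ _)
  have hle : estimate M D z μ ≤ c := hμ.1
  rw [errorShare, h.firstBelow_symmEstimate hμ h1]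
  simp only [extendTop_coe]
  rw [sum_calibrationWith, h1]
  have hA : 0 ≤ ∑ i : Fin n, M μ (z (Fin.castAdd m i)) :=
    Finset.sum_nonneg fun i _ => h.err_nonneg _ _
  unfold estimate at hle
  set A := ∑ i : Fin n, M μ (z (Fin.castAdd m i))
  set R := max 1 (∑ i : Fin m, D μ (z (Fin.natAdd n i)))
  have hR : 0 < R := zero_lt_one.trans_le (le_max_left _ _)
  have hm' : (0 : ℝ) < m := Nat.cast_pos.2 hm
  have hn' : (0 : ℝ) < (n : ℝ) + 1 := by positivity
  have hA' : 0 < 1 + A := by linarith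
  -- Both `hle` and the goal amount to `m (1 + A) ≤ c (n + 1) R`.
  rw [div_le_iff₀ (by positivity)] at hle
  rw [div_mul_div_comm, mul_one, div_le_div_iff₀ hR (by positivity), one_mul]
  have := mul_le_mul_of_nonneg_left hle (mul_pos hn' hm').le
  field_simp at this
  linarith

/-! ### Expectations under the product law. -/

variable (ν : Measure E) [IsProbabilityMeasure ν]

omit h in
theorem measurePreserving_comp_perm (σ : Equiv.Perm (Fin (n + m))) :
    MeasurePreserving (fun z : Fin (n + m) → E => z ∘ σ) (Measure.pi fun _ => ν)
      (Measure.pi fun _ => ν) := by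
  exact measurePreserving_arrowCongr' (fun _ => ν) (fun _ => ν) σ.symm (MeasurableEquiv.refl E)
    fun _ => MeasurePreserving.id ν

theorem integrable_errorShare (c : ℝ) (j : Fin m) {i : Fin (n + m)}
    (hi : i ∈ calibrationWith n j) :
    Integrable (errorShare M D c j i) (Measure.pi fun _ : Fin (n + m) => ν) :=
  Integrable.of_bound (h.measurable_errorShare c j i).aestronglyMeasurable 1
    (ae_of_all _ fun z => by
      rw [Real.norm_of_nonneg (h.errorShare_nonneg c j i z)]
      exact h.errorShare_le_one c j hi z)

theorem integrable_proportion (c : ℝ) :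
    Integrable (proportion M D c) (Measure.pi fun _ : Fin (n + m) => ν) :=
  Integrable.of_bound (h.measurable_proportion c).aestronglyMeasurable 1
    (ae_of_all _ fun z => by
      rw [Real.norm_of_nonneg (h.proportion_nonneg c z)]
      exact h.proportion_le_one c z)

theorem integral_errorShare_eq (c : ℝ) {j : Fin m} {a b : Fin (n + m)}
    (ha : a ∈ calibrationWith n j) (hb : b ∈ calibrationWith n j) :
    ∫ z, errorShare M D c j a z ∂(Measure.pi fun _ : Fin (n + m) => ν) =
      ∫ z, errorShare M D c j b z ∂(Measure.pi fun _ : Fin (n + m) => ν) := by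
  have hmp := measurePreserving_comp_perm (n := n) (m := m) ν (Equiv.swap a b)
  rw [← hmp.map_eq, integral_map hmp.measurable.aemeasurable
    (h.measurable_errorShare c j a).aestronglyMeasurable, hmp.map_eq]
  simp only [errorShare_swap c ha hb]

theorem integral_errorShare_le (c : ℝ) {j : Fin m} {a : Fin (n + m)}
    (ha : a ∈ calibrationWith n j) :
    ∫ z, errorShare M D c j a z ∂(Measure.pi fun _ : Fin (n + m) => ν) ≤ 1 / ((n : ℝ) + 1) := by
  have h1 : ∑ i ∈ calibrationWith n j,
      ∫ z, errorShare M D c j i z ∂(Measure.pi fun _ : Fin (n + m) => ν) ≤ 1 := by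
    rw [← integral_finsetSum _ fun i hi => h.integrable_errorShare ν c j hi]
    refine (integral_mono (integrable_finsetSum _ fun i hi => h.integrable_errorShare ν c j hi)
      (integrable_const (1 : ℝ)) fun z => sum_errorShare_le_one c j z).trans ?_
    simp
  rw [Finset.sum_congr rfl fun i hi => h.integral_errorShare_eq ν c hi ha, Finset.sum_const,
    card_calibrationWith, nsmul_eq_mul] at h1
  rw [le_div_iff₀ (by positivity)]
  push_cast at h1
  linarith

theorem integral_proportion_le (hm : 0 < m) {c : ℝ} (hc : 0 ≤ c) :
    ∫ z, proportion M D c z ∂(Measure.pi fun _ : Fin (n + m) => ν) ≤ c := by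
  have hint (j : Fin m) := h.integrable_errorShare ν c j (natAdd_mem_calibrationWith n j)
  have hm' : (0 : ℝ) < m := Nat.cast_pos.2 hm
  calc ∫ z, proportion M D c z ∂(Measure.pi fun _ : Fin (n + m) => ν)
      ≤ ∫ z, c * ((n : ℝ) + 1) / m * ∑ j : Fin m, errorShare M D c j (Fin.natAdd n j) z
          ∂(Measure.pi fun _ : Fin (n + m) => ν) :=
        integral_mono (h.integrable_proportion ν c)
          ((integrable_finsetSum _ fun j _ => hint j).const_mul _)
          fun z => h.proportion_le_sum_errorShare hm hc z
    _ = c * ((n : ℝ) + 1) / m * ∑ j : Fin m, ∫ z, errorShare M D c j (Fin.natAdd n j) z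
          ∂(Measure.pi fun _ : Fin (n + m) => ν) := by
        rw [integral_const_mul, integral_finsetSum _ fun j _ => hint j]
    _ ≤ c * ((n : ℝ) + 1) / m * ∑ _j : Fin m, 1 / ((n : ℝ) + 1) := by
        gcongr with j
        exact h.integral_errorShare_le ν c (natAdd_mem_calibrationWith n j)
    _ = c := by
        simp only [Finset.sum_const, Finset.card_univ, Fintype.card_fin, nsmul_eq_mul]
        field_simp

end IsSelection

end Selection

/-! ### Prediction sets as an instance of a selection. -/

section PredictionSets

variable {𝒳 𝒴 : Type*} {N : ℕ} {α : ℝ} {I : Fin N → Set 𝒴} {w : Set 𝒴 → ℝ}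
  {phat : 𝒳 → Set 𝒴 → ℝ}

theorem mem_maximizers {μ : ℝ≥0} {x : 𝒳} {k : Fin N} :
    k ∈ maximizers α I w phat μ x ↔
      ∀ j, line α w phat x (I j) μ ≤ line α w phat x (I k) μ := by
  simp [maximizers]

theorem mem_lightMaximizers {μ : ℝ≥0} {x : 𝒳} {k : Fin N} :
    k ∈ lightMaximizers α I w phat μ x ↔ k ∈ maximizers α I w phat μ x ∧
      ∀ j ∈ maximizers α I w phat μ x, w (I k) ≤ w (I j) := by
  simp [lightMaximizers]

variable [NeZero N]

variable (α I w phat) in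
/-- The index of the set `predSet α I w phat μ x` in the list. -/
noncomputable def predIndex (μ : ℝ≥0) (x : 𝒳) : Fin N :=
  (lightMaximizers α I w phat μ x).min' (lightMaximizers_nonempty α I w phat μ x)

theorem predSet_eq (μ : ℝ≥0) (x : 𝒳) :
    predSet α I w phat μ x = I (predIndex α I w phat μ x) := rfl

theorem predIndex_eq_iff {μ : ℝ≥0} {x : 𝒳} {k : Fin N} :
    predIndex α I w phat μ x = k ↔ k ∈ lightMaximizers α I w phat μ x ∧
      ∀ j ∈ lightMaximizers α I w phat μ x, k ≤ j :=
  Finset.min'_eq_iff _ _ _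

theorem envelope_pos_iff {μ : ℝ≥0} {x : 𝒳} :
    0 < envelope α I w phat μ x ↔ ∃ k, 0 < line α w phat x (I k) μ := by
  simp [envelope]

/-- A line of negative slope only grows to the left. Otherwise `phat x C ≥ 1 - α > 0`, so the
intercept is positive and the line is positive throughout. -/
theorem line_pos_of_le (hα1 : α < 1) {x : 𝒳} {C : Set 𝒴} (hw : 0 < w C) (hp : 0 ≤ phat x C)
    {μ ν : ℝ≥0} (hνμ : ν ≤ μ) (hpos : 0 < line α w phat x C μ) : 0 < line α w phat x C ν := by
  unfold line at *
  have h1 : (ν : ℝ) ≤ μ := hνμ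
  have h2 : (0 : ℝ) ≤ ν := ν.2
  have h3 : 0 ≤ w C * phat x C := mul_nonneg hw.le hp
  by_cases hb : phat x C < 1 - α
  · nlinarith
  · push Not at hb
    have : 0 < w C * phat x C := mul_pos hw (by linarith)
    have : 0 ≤ (ν : ℝ) * (phat x C - (1 - α)) := mul_nonneg h2 (by linarith)
    linarith

theorem continuous_line (x : 𝒳) (C : Set 𝒴) : Continuous (line α w phat x C) := by
  unfold line
  fun_prop

theorem envelope_pos_of_le (hα1 : α < 1) (hw : ∀ k, 0 < w (I k))
    (hphat : ∀ x k, phat x (I k) ∈ Set.Icc (0 : ℝ) 1) {x : 𝒳} {μ ν : ℝ≥0} (hνμ : ν ≤ μ)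
    (hpos : 0 < envelope α I w phat μ x) : 0 < envelope α I w phat ν x := by
  rw [envelope_pos_iff] at *
  obtain ⟨k, hk⟩ := hpos
  exact ⟨k, line_pos_of_le hα1 (hw k) (hphat x k).1 hνμ hk⟩

theorem decision_right (hα1 : α < 1) (hw : ∀ k, 0 < w (I k))
    (hphat : ∀ x k, phat x (I k) ∈ Set.Icc (0 : ℝ) 1) (x : 𝒳) (μ : ℝ≥0) :
    ∀ᶠ ν in 𝓝[≥] μ, decision α I w phat ν x = decision α I w phat μ x := by
  by_cases hpos : 0 < envelope α I w phat μ x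
  · obtain ⟨k, hk⟩ := envelope_pos_iff.1 hpos
    have h1 : ∀ᶠ ν in 𝓝[≥] μ, 0 < line α w phat x (I k) ν :=
      nhdsWithin_le_nhds (((continuous_line x (I k)).tendsto μ).eventually_const_lt hk)
    filter_upwards [h1] with ν hν
    simp only [decision, hpos, envelope_pos_iff.2 ⟨k, hν⟩]
  · filter_upwards [self_mem_nhdsWithin] with ν hν
    have : ¬ 0 < envelope α I w phat ν x := fun h =>
      hpos (envelope_pos_of_le hα1 hw hphat hν h)
    simp only [decision, hpos, this]

/-- Strict inequalities between lines persist nearby, so only ties at `μ` matter. Among lines tied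
at a positive value the smallest weight has the largest slope, so the chosen line stays maximal just
to the right. -/
theorem predIndex_right (hα1 : α < 1) (hw : ∀ k, 0 < w (I k))
    {x : 𝒳} {μ : ℝ≥0}
    (hpos : 0 < envelope α I w phat μ x) :
    ∀ᶠ ν in 𝓝[≥] μ, predIndex α I w phat ν x = predIndex α I w phat μ x := by
  obtain ⟨hlight, hmin⟩ := predIndex_eq_iff.1 (rfl : predIndex α I w phat μ x = _)
  set k := predIndex α I w phat μ x
  obtain ⟨hmax, hwmin⟩ := mem_lightMaximizers.1 hlight
  rw [mem_maximizers] at hmax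
  have hkpos : 0 < line α w phat x (I k) μ := by
    obtain ⟨j, hj⟩ := envelope_pos_iff.1 hpos
    exact hj.trans_le (hmax j)
  have hstrict : ∀ᶠ ν in 𝓝[≥] μ, ∀ j, line α w phat x (I j) μ < line α w phat x (I k) μ →
      line α w phat x (I j) ν < line α w phat x (I k) ν := by
    refine eventually_all.2 fun j => ?_
    by_cases hj : line α w phat x (I j) μ < line α w phat x (I k) μ
    · filter_upwards [nhdsWithin_le_nhds (((continuous_line x (I j)).tendsto μ).eventually_lt
        ((continuous_line x (I k)).tendsto μ) hj)] with ν hν _ using hν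
    · exact Eventually.of_forall fun ν h => absurd h hj
  filter_upwards [hstrict, self_mem_nhdsWithin] with ν hν hμν
  have hμν' : (μ : ℝ) ≤ ν := hμν
  have htie (j) (hj : line α w phat x (I j) μ = line α w phat x (I k) μ) :
      j ∈ maximizers α I w phat μ x := mem_maximizers.2 fun i => (hmax i).trans_eq hj.symm
  have hslope (j) (hj : line α w phat x (I j) μ = line α w phat x (I k) μ) :
      phat x (I j) ≤ phat x (I k) := by
    have hwj := hwmin j (htie j hj)
    unfold line at hj hkpos
    have hμ0 : (0 : ℝ) ≤ μ := μ.2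
    have hwk := hw k
    by_contra! hlt
    -- Each line equals `phat * (w + μ) - μ * (1 - α)`; at a tie these products agree, so a larger
    -- `phat` requires a smaller weight.
    have hprod : 0 < phat x (I k) * (w (I k) + μ) := by nlinarith
    have hpk : 0 < phat x (I k) := pos_of_mul_pos_left hprod (by linarith)
    have : phat x (I k) * (w (I k) + μ) < phat x (I j) * (w (I j) + μ) :=
      mul_lt_mul hlt (by linarith) (by linarith) (by linarith)
    linarith
  have hkmax : k ∈ maximizers α I w phat ν x := by
    refine mem_maximizers.2 fun j => ?_
    rcases (hmax j).lt_or_eq with hlt | heq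
    · exact (hν j hlt).le
    · have hs := hslope j heq
      unfold line at heq ⊢
      nlinarith
  -- Maximizers at `ν` are among those at `μ`, so `k` still wins both tie-breaks.
  have htie' (j) (hj : j ∈ maximizers α I w phat ν x) : j ∈ maximizers α I w phat μ x := by
    refine htie j ((hmax j).eq_of_not_lt fun hlt => ?_)
    exact (hν j hlt).not_ge (mem_maximizers.1 hj k)
  refine predIndex_eq_iff.2 ⟨mem_lightMaximizers.2 ⟨hkmax, fun j hj => hwmin j (htie' j hj)⟩,
    fun j hj => hmin j ?_⟩
  obtain ⟨hj1, hj2⟩ := mem_lightMaximizers.1 hj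
  exact mem_lightMaximizers.2 ⟨htie' j hj1, fun i hi => (hj2 k hkmax).trans (hwmin i hi)⟩

variable (α I w phat) in
/-- The indicator that a prediction set is reported for `e.1` and misses `e.2`. -/
noncomputable def falseCoverage (μ : ℝ≥0) (e : 𝒳 × 𝒴) : ℝ :=
  miss (predSet α I w phat μ e.1) e.2 * decision α I w phat μ e.1

theorem miss_zero_or_one (C : Set 𝒴) (y : 𝒴) : miss C y = 0 ∨ miss C y = 1 := by
  unfold miss
  split_ifs <;> simp

theorem decision_zero_or_one (μ : ℝ≥0) (x : 𝒳) :
    decision α I w phat μ x = 0 ∨ decision α I w phat μ x = 1 := by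
  unfold decision
  split_ifs <;> simp

theorem miss_anti {C C' : Set 𝒴} (h : C ⊆ C') (y : 𝒴) : miss C' y ≤ miss C y := by
  by_cases h1 : y ∈ C'
  · have : miss C' y = 0 := by simp [miss, h1]
    rcases miss_zero_or_one C y with h | h <;> simp [this, h]
  · have h2 : y ∉ C := fun hy => h1 (h hy)
    simp [miss, h1, h2]

theorem decision_antitone (hα1 : α < 1) (hw : ∀ k, 0 < w (I k))
    (hphat : ∀ x k, phat x (I k) ∈ Set.Icc (0 : ℝ) 1) (x : 𝒳) :
    Antitone fun μ => decision α I w phat μ x := by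
  intro ν μ hνμ
  simp only [decision]
  split_ifs with h1 h2 h2
  · exact le_rfl
  · exact absurd (envelope_pos_of_le hα1 hw hphat hνμ h1) h2
  · exact zero_le_one
  · exact le_rfl

/-! ### Measurability and the selection structure. -/

section Measurability

variable [MeasurableSpace 𝒳] [MeasurableSpace 𝒴]

omit [NeZero N] [MeasurableSpace 𝒴] in
theorem measurable_line (hphat_meas : ∀ k, Measurable fun x => phat x (I k)) (k : Fin N) :
    Measurable fun p : ℝ≥0 × 𝒳 => line α w phat p.2 (I k) p.1 := by
  have h : Measurable fun p : ℝ≥0 × 𝒳 => phat p.2 (I k) :=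
    (hphat_meas k).comp measurable_snd
  have h' : Measurable fun p : ℝ≥0 × 𝒳 => (p.1 : ℝ) := by fun_prop
  exact (measurable_const.mul h).add (h'.mul (h.sub measurable_const))

omit [MeasurableSpace 𝒴] in
theorem measurable_decision (hphat_meas : ∀ k, Measurable fun x => phat x (I k)) :
    Measurable fun p : ℝ≥0 × 𝒳 => decision α I w phat p.1 p.2 := by
  unfold decision
  refine Measurable.ite ?_ measurable_const measurable_const
  simp only [envelope_pos_iff, Set.ofPred_exists]
  exact MeasurableSet.iUnion fun k =>
    measurableSet_lt measurable_const (measurable_line hphat_meas k)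

omit [MeasurableSpace 𝒴] in
theorem measurable_predIndex (hphat_meas : ∀ k, Measurable fun x => phat x (I k)) :
    Measurable fun p : ℝ≥0 × 𝒳 => predIndex α I w phat p.1 p.2 := by
  have hmax (k : Fin N) :
      Measurable fun p : ℝ≥0 × 𝒳 => k ∈ maximizers α I w phat p.1 p.2 := by
    simp only [mem_maximizers]
    exact Measurable.forall fun j => measurableSet_setOfPred.1 <|
      measurableSet_le (measurable_line hphat_meas j) (measurable_line hphat_meas k)
  have hlight (k : Fin N) :
      Measurable fun p : ℝ≥0 × 𝒳 => k ∈ lightMaximizers α I w phat p.1 p.2 := by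
    simp only [mem_lightMaximizers]
    exact (hmax k).and (Measurable.forall fun j => (hmax j).imp measurable_const)
  refine measurable_to_countable' fun k => ?_
  have : (fun p : ℝ≥0 × 𝒳 => predIndex α I w phat p.1 p.2) ⁻¹' {k} =
      {p | k ∈ lightMaximizers α I w phat p.1 p.2 ∧
        ∀ j, j ∈ lightMaximizers α I w phat p.1 p.2 → k ≤ j} := by
    ext p
    simp [predIndex_eq_iff]
  rw [this]
  exact measurableSet_setOfPred.2 <|
    (hlight k).and (Measurable.forall fun j => (hlight j).imp measurable_const)

theorem measurable_falseCoverage (hI : ∀ k, MeasurableSet (I k))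
    (hphat_meas : ∀ k, Measurable fun x => phat x (I k)) :
    Measurable fun p : ℝ≥0 × (𝒳 × 𝒴) => falseCoverage α I w phat p.1 p.2 := by
  have hx : Measurable fun p : ℝ≥0 × (𝒳 × 𝒴) => (p.1, p.2.1) :=
    measurable_fst.prodMk (measurable_fst.comp measurable_snd)
  have hy : Measurable fun p : ℝ≥0 × (𝒳 × 𝒴) => p.2.2 :=
    measurable_snd.comp measurable_snd
  -- The random set enters only through its index in the finite type `Fin N`.
  have hmiss : Measurable fun q : Fin N × 𝒴 => miss (I q.1) q.2 :=
    measurable_from_prod_countable_right fun k => by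
      unfold miss
      exact Measurable.ite (hI k).compl measurable_const measurable_const
  have hk := (measurable_predIndex (α := α) (w := w) hphat_meas).comp hx
  have h1 := hmiss.comp (hk.prodMk hy)
  have h2 := (measurable_decision (α := α) (w := w) hphat_meas).comp hx
  exact h1.mul h2

theorem isSelection_falseCoverage (hα1 : α < 1) (hI : ∀ k, MeasurableSet (I k))
    (hw : ∀ k, 0 < w (I k)) (hphat_meas : ∀ k, Measurable fun x => phat x (I k))
    (hphat : ∀ x k, phat x (I k) ∈ Set.Icc (0 : ℝ) 1) (hnested : Nested α I w phat) :
    IsSelection (falseCoverage α I w phat) fun μ e => decision α I w phat μ e.1 where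
  err_zero_or_one μ e := by
    unfold falseCoverage
    rcases miss_zero_or_one (predSet α I w phat μ e.1) e.2 with h | h <;>
      rcases decision_zero_or_one (α := α) (I := I) (w := w) (phat := phat) μ e.1 with h' | h' <;>
      simp [h, h']
  sel_zero_or_one μ e := decision_zero_or_one μ e.1
  err_le_sel μ e := by
    unfold falseCoverage
    rcases miss_zero_or_one (predSet α I w phat μ e.1) e.2 with h | h <;>
      rcases decision_zero_or_one (α := α) (I := I) (w := w) (phat := phat) μ e.1 with h' | h' <;>
      simp [h, h']
  err_antitone e ν μ hνμ := by
    refine mul_le_mul (miss_anti ?_ _) (decision_antitone hα1 hw hphat e.1 hνμ) ?_ ?_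
    · rcases hνμ.lt_or_eq with h | rfl
      · exact hnested e.1 ν μ h
      · exact subset_rfl
    · rcases decision_zero_or_one (α := α) (I := I) (w := w) (phat := phat) μ e.1 with h | h <;>
        simp [h]
    · rcases miss_zero_or_one (predSet α I w phat ν e.1) e.2 with h | h <;> simp [h]
  err_right e μ := by
    by_cases hpos : 0 < envelope α I w phat μ e.1
    · filter_upwards [predIndex_right hα1 hw hpos, decision_right hα1 hw hphat e.1 μ]
        with ν h1 h2
      simp only [falseCoverage, predSet_eq, h1, h2]
    -- Here the chosen set may change just to the right, but nothing is reported, so the error stays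
    -- zero.
    · filter_upwards [decision_right hα1 hw hphat e.1 μ] with ν h2
      have : decision α I w phat μ e.1 = 0 := if_neg hpos
      simp only [falseCoverage, h2, this, mul_zero]
  sel_right e μ := decision_right hα1 hw hphat e.1 μ
  measurable_err := measurable_falseCoverage hI hphat_meas
  measurable_sel := by
    have hx : Measurable fun p : ℝ≥0 × (𝒳 × 𝒴) => (p.1, p.2.1) :=
    measurable_fst.prodMk (measurable_fst.comp measurable_snd)
    have h := (measurable_decision (α := α) (w := w) hphat_meas).comp hx
    exact h

end Measurability

theorem fcp_eq_proportion {n m : ℕ} (z : Fin (n + m) → 𝒳 × 𝒴) :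
    fcp α I w phat z =
      proportion (falseCoverage α I w phat) (fun μ e => decision α I w phat μ e.1) α z := by
  have hμ : muAlpha α I w phat z = firstBelow (estimate (falseCoverage α I w phat)
      (fun μ e => decision α I w phat μ e.1) z) α := rfl
  unfold fcp proportion
  rw [hμ]
  -- The two proportions agree at every level in `[0, ∞]`, whatever the stopping rule.
  generalize firstBelow _ _ = μ
  induction μ with
  | top => simp [decisionTop]
  | coe μ => simp [decisionTop, predSetTop, falseCoverage]

end PredictionSets

end OGInfoSP

/-! ### Transfer to the i.i.d. sample. -/

theorem theorem4p1 {𝒳 𝒴 Ω : Type*} [MeasurableSpace 𝒳] [MeasurableSpace 𝒴] [MeasurableSpace Ω]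
    (P : Measure Ω) [IsProbabilityMeasure P]
    {n m N : ℕ} (hm : 0 < m) [NeZero N]
    (PXY : Measure (𝒳 × 𝒴))
    (Z : Fin (n + m) → Ω → 𝒳 × 𝒴)
    (hlaw : ∀ i, HasLaw (Z i) PXY P)
    (hindep : iIndepFun Z P)
    (α : ℝ) (hα : 0 < α) (hα1 : α < 1)
    (I : Fin N → Set 𝒴) (hI : ∀ k, MeasurableSet (I k))
    (w : Set 𝒴 → ℝ) (hw : ∀ k, 0 < w (I k))
    (phat : 𝒳 → Set 𝒴 → ℝ)
    (hphat_meas : ∀ k, Measurable fun x => phat x (I k))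
    (hphat : ∀ x k, phat x (I k) ∈ Set.Icc (0 : ℝ) 1)
    (hnested : OGInfoSP.Nested α I w phat) :
    (∀ z : Fin (n + m) → 𝒳 × 𝒴, (OGInfoSP.feasible α I w phat z).Nonempty →
      ∃ μ : ℝ≥0, OGInfoSP.muAlpha α I w phat z = μ ∧
        IsLeast (OGInfoSP.feasible α I w phat z) μ) ∧
    Integrable (fun ω => OGInfoSP.fcp α I w phat fun i => Z i ω) P ∧
    ∫ ω, OGInfoSP.fcp α I w phat (fun i => Z i ω) ∂P ≤ α := by
  have h := OGInfoSP.isSelection_falseCoverage hα1 hI hw hphat_meas hphat hnested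
  have hne : Nonempty (Fin (n + m)) := ⟨⟨n, by omega⟩⟩
  have hPXY : IsProbabilityMeasure PXY := 
    (hlaw ⟨n, by omega⟩).isProbabilityMeasure_iff.1 inferInstance
  have hZ : AEMeasurable (fun ω i => Z i ω) P :=
    aemeasurable_pi_lambda _ fun i => (hlaw i).aemeasurable
  have hmap : P.map (fun ω i => Z i ω) = Measure.pi fun _ => PXY := by
    rw [(iIndepFun_iff_map_fun_eq_pi_map fun i => (hlaw i).aemeasurable).1 hindep]
    simp only [(hlaw _).map_eq]
  have hint := h.integrable_proportion (n := n) (m := m) PXY α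
  have hle := h.integral_proportion_le (n := n) PXY hm hα.le
  rw [← hmap] at hint hle
  refine ⟨fun z hz => ?_, ?_, ?_⟩
  · obtain ⟨μ, hμ⟩ := OGInfoSP.exists_isLeast_of_eventually_eq (h.estimate_right z) hz
    exact ⟨μ, OGInfoSP.firstBelow_eq_coe hμ, hμ⟩
  · simp only [OGInfoSP.fcp_eq_proportion]
    exact hint.comp_aemeasurable hZ
  · simp only [OGInfoSP.fcp_eq_proportion]
    rwa [integral_map hZ hint.aestronglyMeasurable] at hle
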